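/- Let $\Gamma\subset\mathrm{SL}(2,\mathbb R)$ be commensurable with $\mathrm{SL}(2,\mathbb Z)$, let $\psi$ be a character of $\Gamma$ and $k\in\mathbb Z$. A holomorphic function $f$ on the upper half-plane $\mathbb H$ is called quasimodular of weight $k$, depth $1$ and character $\psi$ on $\Gamma$ if there is a holomorphic function $h\not\equiv 0$ on $\mathbb H$ such that $F(z)=f(z)+\frac{h(z)}{z-\overline z}$ satisfies $F(\gamma z)=\psi(\gamma)(cz+d)^kF(z)$ for all $\gamma=\begin{pmatrix}a&b\\c&d\end{pmatrix}\in\Gamma$ and has a finite limit at every cusp, that is, $F|_k\sigma$ has a finite limit as $\operatorname{Im}z\to\infty$ for every $\sigma\in\mathrm{SL}(2,\mathbb Z)$. (If $f=f_1\phi+f_0$ with modular forms $f_1,f_0$ of weights $k-2,k$ and character $\psi$, and $\phi$ is quasimodular of weight $2$ and depth $1$ with $(cz+d)^{-2}\phi(\gamma z)=\phi(z)+\frac{\alpha c}{cz+d}$, then $h=\alpha f_1$.) For such $f$ put $$W_f(z)=\det\begin{pmatrix} zf(z)+h(z) & (zf(z)+h(z))'\\ f(z)& f'(z)\end{pmatrix},\qquad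 g(z)=\frac{f(z)}{\sqrt{W_f(z)}},\qquad Q(z)=-\frac1{4\pi^2}\frac{g''(z)}{g(z)},$$ a meromorphic function on $\mathbb H$, and consider the equation $y''=-4\pi^2Q(z)y$. It is Fuchsian at $z_0\in\mathbb H$ if $Q(z)=A(z-z_0)^{-2}+O((z-z_0)^{-1})$ near $z_0$, and its local exponents at $z_0$ are then the two roots, with multiplicity, of $r(r-1)=-4\pi^2A$. For $N\in\{2,3\}$ let $\Gamma_0^+(N)$ be the subgroup of $\mathrm{SL}(2,\mathbb R)$ generated by $\Gamma_0(N)$ and $\frac1{\sqrt N}\begin{pmatrix}0&-1\\N&0\end{pmatrix}$, and let $\chi$ be the character of $\Gamma_0^+(3)$ with $\chi\left(\frac1{\sqrt3}\begin{pmatrix}0&-1\\3&0\end{pmatrix}\right)=\chi\left(\frac1{\sqrt3}\begin{pmatrix}3&-1\\3&0\end{pmatrix}\right)=-i$. In each of the following cases the equation is Fuchsian at the points $z_0$ named there, its local exponents at $z_0$ are $\frac12\pm\kappa_{z_0}$ with $2\kappa_{z_0}$ a positive integer, and the stated coprimality holds. (i) Let $f$ be quasimodular of weight $k$ and depth $1$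 on $\mathrm{SL}(2,\mathbb Z)$ with trivial character. For $\rho=(1+\sqrt{-3})/2$ and $i=\sqrt{-1}$ we have $(2\kappa_\rho,3)=(2\kappa_i,2)=1$. (ii) Let $f$ be quasimodular of weight $k$ and depth $1$ on $\Gamma_0^+(2)$ with a character that is trivial on $\Gamma_0(2)$ (that is, $f$ has Atkin–Lehner sign $+$ or $-$). For $\rho_1=i/\sqrt2$ and $\rho_2=(1+i)/2$ we have $(2\kappa_{\rho_1},2)=(2\kappa_{\rho_2},4)=1$. (iii) Let $m\in\{0,1,2,3\}$, $k\equiv m\pmod 2$, and let $f$ be quasimodular of weight $k$ and depth $1$ on $\Gamma_0^+(3)$ with character $\chi^m$. For $\rho_1=i/\sqrt3$ and $\rho_2=(3+\sqrt{-3})/6$ we have $(2\kappa_{\rho_1},2)=(2\kappa_{\rho_2},6)=1$. -/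

import Mathlib

open UpperHalfPlane Filter Topology ModularForm
open scoped MatrixGroups Manifold ComplexConjugate

noncomputable section

namespace QuasiMODE

/-! ### The groups `SL(2, ℤ)` and `Γ₀⁺(N)` inside `SL(2, ℝ)` -/

/-- The modular group `SL(2, ℤ)` as a subgroup of `SL(2, ℝ)`. -/
def modularGroup : Subgroup SL(2, ℝ) :=
  (Matrix.SpecialLinearGroup.map (Int.castRingHom ℝ)).range

/-- The group `Γ₀(N)` as a subgroup of `SL(2, ℝ)`. -/
def gamma0 (N : ℕ) : Subgroup SL(2, ℝ) :=
  (CongruenceSubgroup.Gamma0 N).map (Matrix.SpecialLinearGroup.map (Int.castRingHom ℝ))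

/-- The matrix `(1/√N) (0, -1; N, 0)`. -/
def fricke (N : ℕ) [NeZero N] : SL(2, ℝ) :=
  ⟨!![0, -(1 / √(N : ℝ)); √(N : ℝ), 0], by
    have h : √(N : ℝ) ≠ 0 := by
      have : (0 : ℝ) < N := by exact_mod_cast Nat.pos_of_ne_zero (NeZero.ne N)
      positivity
    simp [Matrix.det_fin_two, h]⟩

/-- The matrix `(1, 1; 0, 1)`. -/
def translation : SL(2, ℝ) := ⟨!![1, 1; 0, 1], by simp [Matrix.det_fin_two]⟩

/-- For a prime `N`, the group `Γ₀⁺(N)` generated by `Γ₀(N)` and its only nontrivial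
Atkin-Lehner involution. -/
def gamma0Plus (N : ℕ) [NeZero N] : Subgroup SL(2, ℝ) :=
  Subgroup.closure ((gamma0 N : Set SL(2, ℝ)) ∪ {fricke N})

/-! ### Nearly holomorphic modular forms and quasimodular forms of depth at most one -/

/-- The function `f(z) + h(z) / (z - conj z)` on the upper half-plane. -/
def nearlyHolomorphic (f h : ℍ → ℂ) : ℍ → ℂ :=
  fun z => f z + h z / ((z : ℂ) - conj (z : ℂ))

/-- `f + h / (z - conj z)` is a nearly holomorphic modular form of weight `k` and character `χ`
on `Γ` (a group commensurable with `SL(2, ℤ)`, so that its cusps are the `σ ∞`, `σ ∈ SL(2, ℤ)`).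
Equivalently, `f` is a quasimodular form of weight `k`, depth at most `1` and character `χ` on `Γ`,
being the holomorphic part of that nearly holomorphic form. The depth is `1` if `h ≠ 0`; it
is `0`, and `f` is a modular form, if `h = 0`. -/
structure IsQuasimodular (Γ : Subgroup SL(2, ℝ)) (χ : Γ →* ℂ) (k : ℤ) (f h : ℍ → ℂ) :
    Prop where
  holo : MDifferentiable 𝓘(ℂ) 𝓘(ℂ) f
  holo_coeff : MDifferentiable 𝓘(ℂ) 𝓘(ℂ) h
  transform : ∀ (γ : Γ) (z : ℍ), nearlyHolomorphic f h ((γ : SL(2, ℝ)) • z) =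
    χ γ * (((γ : SL(2, ℝ)) 1 0 : ℝ) * (z : ℂ) + ((γ : SL(2, ℝ)) 1 1 : ℝ)) ^ k *
      nearlyHolomorphic f h z
  cusps : ∀ σ : SL(2, ℤ), ∃ L : ℂ,
    Tendsto (nearlyHolomorphic f h ∣[k] σ) atImInfty (𝓝 L)

/-- If `φ` is quasimodular of weight `2` with nearly holomorphic completion `φ + α / (z - conj z)`,
and `f = f₁ φ + f₀` with modular forms `f₁`, `f₀` of weights `k - 2`, `k`, then the coefficient of
`1 / (z - conj z)` attached to `f` is `α f₁`. -/
theorem IsQuasimodular.of_decomposition {Γ : Subgroup SL(2, ℝ)} {χ : Γ →* ℂ} {k : ℤ}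
    {φ f₀ f₁ : ℍ → ℂ} {α : ℂ} (hφ : IsQuasimodular Γ 1 2 φ (fun _ => α))
    (hf₀ : IsQuasimodular Γ χ k f₀ 0) (hf₁ : IsQuasimodular Γ χ (k - 2) f₁ 0) :
    IsQuasimodular Γ χ k (fun z => f₁ z * φ z + f₀ z) (fun z => α * f₁ z) := by
  have key : nearlyHolomorphic (fun z => f₁ z * φ z + f₀ z) (fun z => α * f₁ z) =
      nearlyHolomorphic f₁ 0 * nearlyHolomorphic φ (fun _ => α) + nearlyHolomorphic f₀ 0 := by
    funext z
    simp only [nearlyHolomorphic, Pi.mul_apply, Pi.add_apply, Pi.zero_apply]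
    ring
  refine ⟨(hf₁.holo.mul hφ.holo).add hf₀.holo, mdifferentiable_const.mul hf₁.holo, ?_, ?_⟩
  · intro γ z
    rw [key]
    simp only [Pi.mul_apply, Pi.add_apply]
    rw [hf₁.transform, hφ.transform, hf₀.transform]
    set j : ℂ := (((γ : SL(2, ℝ)) 1 0 : ℝ) * (z : ℂ) + ((γ : SL(2, ℝ)) 1 1 : ℝ)) with hj
    have hj0 : j ≠ 0 := by
      have := denom_ne_zero ((γ : SL(2, ℝ)) : GL (Fin 2) ℝ) z
      simpa [denom, hj] using this
    have : j ^ k = j ^ (k - 2) * j ^ (2 : ℤ) := by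
      rw [← zpow_add₀ hj0]; congr 1; ring
    rw [this]
    simp only [MonoidHom.one_apply]
    ring
  · intro σ
    obtain ⟨L₁, h₁⟩ := hf₁.cusps σ
    obtain ⟨L₂, h₂⟩ := hφ.cusps σ
    obtain ⟨L₀, h₀⟩ := hf₀.cusps σ
    refine ⟨L₁ * L₂ + L₀, ?_⟩
    have h := (h₁.mul h₂).add h₀
    rw [key, SlashAction.add_slash]
    have hk : k = (k - 2) + 2 := by ring
    have e : ((nearlyHolomorphic f₁ 0 * nearlyHolomorphic φ (fun _ => α)) ∣[k] σ) =
        (nearlyHolomorphic f₁ 0 ∣[k - 2] σ) *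
          (nearlyHolomorphic φ (fun _ => α) ∣[(2 : ℤ)] σ) := by
      conv_lhs => rw [hk]
      rw [ModularForm.mul_slash_SL2]
    rw [e]
    exact h

/-! ### The Wronskian, the differential equation and its local exponents -/

/-- The Wronskian `W_f = det (F, F')` with `F = (z f + h, f)ᵗ`. -/
def wronskian (f h : ℍ → ℂ) (z : ℂ) : ℂ :=
  Matrix.det !![z * f (ofComplex z) + h (ofComplex z),
                  deriv (fun w : ℂ => w * f (ofComplex w) + h (ofComplex w)) z;
                f (ofComplex z), deriv (fun w : ℂ => f (ofComplex w)) z]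

/-- A branch near `z₀` of the square root of a function `W` with `W z₀ ≠ 0`. -/
def sqrtBranch (W : ℂ → ℂ) (z₀ z : ℂ) : ℂ :=
  W z₀ ^ (1 / 2 : ℂ) * (W z / W z₀) ^ (1 / 2 : ℂ)

/-- The function `f / √W_f`, for a branch of the square root near `z₀`. -/
def solution (f h : ℍ → ℂ) (z₀ z : ℂ) : ℂ :=
  f (ofComplex z) / sqrtBranch (wronskian f h) z₀ z

/-- The meromorphic function `Q = -(1 / 4π²) g'' / g` with `g = f / √W_f`. The value at a point of
the upper half-plane is meaningful off the discrete set of zeros of `f` and of `W_f`. -/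
def potential (f h : ℍ → ℂ) (z₀ : ℂ) : ℂ :=
  -(1 / (4 * (Real.pi : ℂ) ^ 2)) *
    (deriv (deriv (solution f h z₀)) z₀ / solution f h z₀ z₀)

/-- The equation `y'' = -4π² Q y` is Fuchsian at `z₀`, i.e. `Q` is meromorphic at `z₀` with
`Q = A (z - z₀)⁻² + O((z - z₀)⁻¹)`, and `r₁`, `r₂` are its local exponents at `z₀`, i.e. the roots,
with multiplicity, of the indicial equation `r (r - 1) = -4π² A`. -/
def HasLocalExponents (Q : ℂ → ℂ) (z₀ r₁ r₂ : ℂ) : Prop :=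
  MeromorphicAt Q z₀ ∧ ∃ A : ℂ,
    Tendsto (fun z => (z - z₀) ^ 2 * Q z) (𝓝[≠] z₀) (𝓝 A) ∧
    ∀ r : ℂ, r * (r - 1) + 4 * (Real.pi : ℂ) ^ 2 * A = (r - r₁) * (r - r₂)

/-- The local exponents at `z₀` are `1/2 ± κ` with `2κ` a positive integer prime to `e`
(here `n = 2κ`). -/
def ExponentsCoprime (Q : ℂ → ℂ) (z₀ : ℂ) (e : ℕ) : Prop :=
  ∃ n : ℕ, 0 < n ∧ HasLocalExponents Q z₀ (1 / 2 + (n : ℂ) / 2) (1 / 2 - (n : ℂ) / 2) ∧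
    Nat.gcd n e = 1

set_option linter.unusedSimpArgs false

/-! ### The character of order four of `Γ₀⁺(3)` -/

/-- `g ∈ Γ₀(3)` with upper left entry `a`. -/
def IsType0 (g : SL(2, ℝ)) (a : ℤ) : Prop :=
  ∃ b c d : ℤ, a * d - 3 * b * c = 1 ∧
    g 0 0 = a ∧ g 0 1 = b ∧ g 1 0 = 3 * c ∧ g 1 1 = d

/-- `g = (1/√3) (3a, b; 3c, 3d)` with lower left entry given by `c`. -/
def IsType1 (g : SL(2, ℝ)) (c : ℤ) : Prop :=
  ∃ a b d : ℤ, 3 * a * d - b * c = 1 ∧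
    g 0 0 = √3 * a ∧ √3 * g 0 1 = b ∧ g 1 0 = √3 * c ∧ g 1 1 = √3 * d

theorem sqrt_three_mul_self : √(3 : ℝ) * √3 = 3 := Real.mul_self_sqrt (by norm_num)

theorem IsType0.mul00 {g g' : SL(2, ℝ)} {a a' : ℤ} (h : IsType0 g a) (h' : IsType0 g' a') :
    ∃ x, IsType0 (g * g') x ∧ legendreSym 3 x = legendreSym 3 a * legendreSym 3 a' := by
  obtain ⟨b, c, d, hd, h1, h2, h3, h4⟩ := h
  obtain ⟨b', c', d', hd', h1', h2', h3', h4'⟩ := h'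
  refine ⟨a * a' + 3 * b * c', ⟨a * b' + b * d', c * a' + d * c', 3 * c * b' + d * d', ?_, ?_, ?_,
    ?_, ?_⟩, ?_⟩
  · linear_combination (a' * d' - 3 * b' * c') * hd + hd'
  all_goals try
    simp only [Matrix.SpecialLinearGroup.coe_mul, Matrix.mul_apply, Fin.sum_univ_two, h1, h2, h3,
      h4, h1', h2', h3', h4']
    push_cast
    ring
  rw [← legendreSym.mul, legendreSym.mod, legendreSym.mod 3 (a * a')]
  congr 1
  push_cast
  rw [mul_assoc, Int.add_mul_emod_self_left]

theorem IsType0.mul01 {g g' : SL(2, ℝ)} {a c' : ℤ} (h : IsType0 g a) (h' : IsType1 g' c') :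
    ∃ x, IsType1 (g * g') x ∧ legendreSym 3 x = legendreSym 3 a * legendreSym 3 c' := by
  obtain ⟨b, c, d, hd, h1, h2, h3, h4⟩ := h
  obtain ⟨a', b', d', hd', h1', h2', h3', h4'⟩ := h'
  have hs := sqrt_three_mul_self
  refine ⟨3 * c * a' + d * c', ⟨a * a' + b * c', a * b' + 3 * b * d', c * b' + d * d', ?_, ?_, ?_,
    ?_, ?_⟩, ?_⟩
  · linear_combination (3 * a' * d' - b' * c') * hd + hd'
  · simp only [Matrix.SpecialLinearGroup.coe_mul, Matrix.mul_apply, Fin.sum_univ_two, h1, h2, h3,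
      h4, h1', h3', h4']
    push_cast
    ring
  · simp only [Matrix.SpecialLinearGroup.coe_mul, Matrix.mul_apply, Fin.sum_univ_two, h1, h2, h3,
      h4, h1', h3', h4']
    push_cast
    linear_combination (a : ℝ) * h2' + (b : ℝ) * d' * hs
  · simp only [Matrix.SpecialLinearGroup.coe_mul, Matrix.mul_apply, Fin.sum_univ_two, h1, h2, h3,
      h4, h1', h3', h4']
    push_cast
    ring
  · simp only [Matrix.SpecialLinearGroup.coe_mul, Matrix.mul_apply, Fin.sum_univ_two, h1, h2, h3,
      h4, h1', h3', h4']
    push_cast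
    linear_combination (√3 * (c : ℝ)) * h2' - (c : ℝ) * (g' 0 1) * hs
  · have had : legendreSym 3 a * legendreSym 3 d = 1 := by
      rw [← legendreSym.mul, show a * d = 1 + 3 * (b * c) by linear_combination hd,
        legendreSym.mod]
      push_cast
      rw [Int.add_mul_emod_self_left]
      exact legendreSym.at_one 3
    have hda : legendreSym 3 d = legendreSym 3 a := by
      rcases Int.eq_one_or_neg_one_of_mul_eq_one' had with ⟨p, q⟩ | ⟨p, q⟩ <;> rw [p, q]
    rw [← hda, ← legendreSym.mul, legendreSym.mod, legendreSym.mod 3 (d * c')]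
    congr 1
    push_cast
    rw [add_comm, mul_assoc, Int.add_mul_emod_self_left]

theorem IsType1.mul10 {g g' : SL(2, ℝ)} {c a' : ℤ} (h : IsType1 g c) (h' : IsType0 g' a') :
    ∃ x, IsType1 (g * g') x ∧ legendreSym 3 x = legendreSym 3 c * legendreSym 3 a' := by
  obtain ⟨a, b, d, hd, h1, h2, h3, h4⟩ := h
  obtain ⟨b', c', d', hd', h1', h2', h3', h4'⟩ := h'
  have hs := sqrt_three_mul_self
  refine ⟨c * a' + 3 * d * c', ⟨a * a' + b * c', 3 * a * b' + b * d', c * b' + d * d', ?_, ?_, ?_,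
    ?_, ?_⟩, ?_⟩
  · linear_combination (a' * d' - 3 * b' * c') * hd + hd'
  · simp only [Matrix.SpecialLinearGroup.coe_mul, Matrix.mul_apply, Fin.sum_univ_two, h1, h3,
      h4, h1', h2', h3', h4']
    push_cast
    linear_combination (√3 * (c' : ℝ)) * h2 - (c' : ℝ) * (g 0 1) * hs
  · simp only [Matrix.SpecialLinearGroup.coe_mul, Matrix.mul_apply, Fin.sum_univ_two, h1, h3,
      h4, h1', h2', h3', h4']
    push_cast
    linear_combination (d' : ℝ) * h2 + (a : ℝ) * b' * hs
  · simp only [Matrix.SpecialLinearGroup.coe_mul, Matrix.mul_apply, Fin.sum_univ_two, h1, h3,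
      h4, h1', h2', h3', h4']
    push_cast
    ring
  · simp only [Matrix.SpecialLinearGroup.coe_mul, Matrix.mul_apply, Fin.sum_univ_two, h1, h3,
      h4, h1', h2', h3', h4']
    push_cast
    ring
  · rw [← legendreSym.mul, legendreSym.mod, legendreSym.mod 3 (c * a')]
    congr 1
    push_cast
    rw [mul_assoc, Int.add_mul_emod_self_left]

theorem IsType1.mul11 {g g' : SL(2, ℝ)} {c c' : ℤ} (h : IsType1 g c) (h' : IsType1 g' c') :
    ∃ x, IsType0 (g * g') x ∧ legendreSym 3 x = -(legendreSym 3 c * legendreSym 3 c') := by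
  obtain ⟨a, b, d, hd, h1, h2, h3, h4⟩ := h
  obtain ⟨a', b', d', hd', h1', h2', h3', h4'⟩ := h'
  have hs := sqrt_three_mul_self
  refine ⟨3 * a * a' + b * c', ⟨a * b' + b * d', c * a' + d * c', c * b' + 3 * d * d', ?_, ?_, ?_,
    ?_, ?_⟩, ?_⟩
  · linear_combination (3 * a' * d' - b' * c') * hd + hd'
  · simp only [Matrix.SpecialLinearGroup.coe_mul, Matrix.mul_apply, Fin.sum_univ_two, h1, h3,
      h4, h1', h3', h4']
    push_cast
    linear_combination (c' : ℝ) * h2 + (a : ℝ) * a' * hs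
  · simp only [Matrix.SpecialLinearGroup.coe_mul, Matrix.mul_apply, Fin.sum_univ_two, h1, h3,
      h4, h1', h3', h4']
    push_cast
    linear_combination (a : ℝ) * h2' + (d' : ℝ) * h2
  · simp only [Matrix.SpecialLinearGroup.coe_mul, Matrix.mul_apply, Fin.sum_univ_two, h1, h3,
      h4, h1', h3', h4']
    push_cast
    linear_combination ((c : ℝ) * a' + d * c') * hs
  · simp only [Matrix.SpecialLinearGroup.coe_mul, Matrix.mul_apply, Fin.sum_univ_two, h1, h3,
      h4, h1', h3', h4']
    push_cast
    linear_combination (c : ℝ) * h2' + (d : ℝ) * d' * hs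
  · have hbc : legendreSym 3 b * legendreSym 3 c = -1 := by
      rw [← legendreSym.mul, show b * c = -1 + 3 * (a * d) by linear_combination -hd,
        legendreSym.mod]
      push_cast
      rw [Int.add_mul_emod_self_left]
      decide
    have hb : legendreSym 3 b = -legendreSym 3 c := by
      rcases Int.eq_one_or_neg_one_of_mul_eq_neg_one' hbc with ⟨p, q⟩ | ⟨p, q⟩ <;> rw [p, q]
      rfl
    rw [← neg_mul, ← hb, ← legendreSym.mul, legendreSym.mod, legendreSym.mod 3 (b * c')]
    congr 1
    push_cast
    rw [add_comm, mul_assoc 3, Int.add_mul_emod_self_left]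

theorem IsType0.unique {g : SL(2, ℝ)} {a a' : ℤ} (h : IsType0 g a) (h' : IsType0 g a') :
    a = a' := by
  obtain ⟨_, _, _, _, h1, _⟩ := h
  obtain ⟨_, _, _, _, h1', _⟩ := h'
  exact_mod_cast h1.symm.trans h1'

theorem IsType1.unique {g : SL(2, ℝ)} {c c' : ℤ} (h : IsType1 g c) (h' : IsType1 g c') :
    c = c' := by
  obtain ⟨_, _, _, _, _, _, h1, _⟩ := h
  obtain ⟨_, _, _, _, _, _, h1', _⟩ := h'
  have := h1.symm.trans h1'
  have h3 : √(3 : ℝ) ≠ 0 := by positivity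
  exact_mod_cast mul_left_cancel₀ h3 this

theorem IsType1.not_type0 {g : SL(2, ℝ)} {c a : ℤ} (h : IsType1 g c) : ¬ IsType0 g a := by
  rintro ⟨b', c', d', hd', h1', h2', h3', h4'⟩
  obtain ⟨a, b, d, hd, h1, h2, h3, h4⟩ := h
  have e : ((a * d : ℤ) : ℝ) * 3 = ((1 + 3 * b' * c' : ℤ) : ℝ) := by
    rw [← hd']
    push_cast
    rw [show (_ : ℝ) - 3 * b' * c' + 3 * b' * c' = _ from sub_add_cancel _ _, ← h1', ← h4', h1, h4]
    linear_combination -((a : ℝ) * d) * sqrt_three_mul_self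
  have e' : (a * d) * 3 = 1 + 3 * b' * c' := by exact_mod_cast e
  rw [mul_assoc 3] at e'
  generalize a * d = x at e'
  generalize b' * c' = y at e'
  omega

open Classical in
/-- `(a, b; 3c, d) ↦ (a / 3)` and `(1/√3) (3a, b; 3c, 3d) ↦ -i (c / 3)`, with Legendre symbols. -/
def chiFun (g : SL(2, ℝ)) : ℂ :=
  if h : ∃ a, IsType0 g a then (legendreSym 3 h.choose : ℂ)
  else if h : ∃ c, IsType1 g c then -Complex.I * (legendreSym 3 h.choose : ℂ)
  else 1

theorem IsType0.chiFun_eq {g : SL(2, ℝ)} {a : ℤ} (h : IsType0 g a) :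
    chiFun g = (legendreSym 3 a : ℂ) := by
  have hex : ∃ a, IsType0 g a := ⟨a, h⟩
  rw [chiFun, dif_pos hex, hex.choose_spec.unique h]

theorem IsType1.chiFun_eq {g : SL(2, ℝ)} {c : ℤ} (h : IsType1 g c) :
    chiFun g = -Complex.I * (legendreSym 3 c : ℂ) := by
  have hex : ∃ c, IsType1 g c := ⟨c, h⟩
  have hn : ¬ ∃ a, IsType0 g a := fun ⟨_, h0⟩ => h.not_type0 h0
  rw [chiFun, dif_neg hn, dif_pos hex, hex.choose_spec.unique h]

theorem isType1_fricke : IsType1 (fricke 3) 1 := by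
  have h3 : √(3 : ℝ) ≠ 0 := by positivity
  refine ⟨0, -1, 0, by norm_num, ?_, ?_, ?_, ?_⟩ <;> simp [fricke, h3]

theorem type_of_mem {g : SL(2, ℝ)} (hg : g ∈ gamma0Plus 3) :
    (∃ a, IsType0 g a) ∨ ∃ c, IsType1 g c := by
  induction hg using Subgroup.closure_induction with
  | mem x hx =>
    rcases hx with ⟨γ, hγ, rfl⟩ | hx
    · left
      have hγ' : ((γ 1 0 : ℤ) : ZMod 3) = 0 := CongruenceSubgroup.Gamma0_mem.mp hγ
      obtain ⟨c, hc⟩ := (ZMod.intCast_zmod_eq_zero_iff_dvd _ _).mp hγ'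
      refine ⟨γ 0 0, γ 0 1, c, γ 1 1, ?_, ?_, ?_, ?_, ?_⟩
      · have := γ.det_coe
        rw [Matrix.det_fin_two, hc] at this
        push_cast at this
        linear_combination this
      · simp
      · simp
      · simp [hc]
      · simp
    · right
      rw [Set.mem_singleton_iff.mp hx]
      exact ⟨1, isType1_fricke⟩
  | one => exact .inl ⟨1, 0, 0, 1, by norm_num, by simp, by simp, by simp, by simp⟩
  | mul x y _ _ hx hy =>
    rcases hx with ⟨a, hx⟩ | ⟨a, hx⟩ <;> rcases hy with ⟨b, hy⟩ | ⟨b, hy⟩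
    · exact .inl ((hx.mul00 hy).imp fun _ h => h.1)
    · exact .inr ((hx.mul01 hy).imp fun _ h => h.1)
    · exact .inr ((hx.mul10 hy).imp fun _ h => h.1)
    · exact .inl ((hx.mul11 hy).imp fun _ h => h.1)
  | inv x _ hx =>
    rcases hx with ⟨a, b, c, d, hd, h1, h2, h3, h4⟩ | ⟨c, a, b, d, hd, h1, h2, h3, h4⟩
    · refine .inl ⟨d, -b, -c, a, by linear_combination hd, ?_, ?_, ?_, ?_⟩ <;>
        simp [Matrix.SpecialLinearGroup.coe_inv, Matrix.adjugate_fin_two, h1, h2, h3, h4]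
    · refine .inr ⟨-c, d, -b, a, by linear_combination hd, ?_, ?_, ?_, ?_⟩ <;>
        simp [Matrix.SpecialLinearGroup.coe_inv, Matrix.adjugate_fin_two, h1, h2, h3, h4]

/-- The character `χ` of `Γ₀⁺(3)` with `χ(S) = χ(R) = -i`, where `S = (1/√3) (0, -1; 3, 0)` and
`R = (1/√3) (3, -1; 3, 0)`. -/
def chi : gamma0Plus 3 →* ℂ where
  toFun g := chiFun g
  map_one' := by
    have h : IsType0 ((1 : gamma0Plus 3) : SL(2, ℝ)) 1 :=
      ⟨0, 0, 1, by norm_num, by simp, by simp, by simp, by simp⟩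
    rw [h.chiFun_eq, legendreSym.at_one]
    norm_num
  map_mul' x y := by
    rw [Subgroup.coe_mul]
    rcases type_of_mem x.2 with ⟨a, hx⟩ | ⟨a, hx⟩ <;> rcases type_of_mem y.2 with ⟨b, hy⟩ | ⟨b, hy⟩
    · obtain ⟨c, hc, h⟩ := hx.mul00 hy
      rw [hc.chiFun_eq, hx.chiFun_eq, hy.chiFun_eq, h]
      push_cast
      ring
    · obtain ⟨c, hc, h⟩ := hx.mul01 hy
      rw [hc.chiFun_eq, hx.chiFun_eq, hy.chiFun_eq, h]
      push_cast
      ring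
    · obtain ⟨c, hc, h⟩ := hx.mul10 hy
      rw [hc.chiFun_eq, hx.chiFun_eq, hy.chiFun_eq, h]
      push_cast
      ring
    · obtain ⟨c, hc, h⟩ := hx.mul11 hy
      rw [hc.chiFun_eq, hx.chiFun_eq, hy.chiFun_eq, h]
      push_cast
      linear_combination -((legendreSym 3 a : ℂ) * legendreSym 3 b) * Complex.I_mul_I

theorem translation_mem (N : ℕ) [NeZero N] : translation ∈ gamma0Plus N := by
  refine Subgroup.subset_closure (.inl ⟨ModularGroup.T, ?_, ?_⟩)
  · exact CongruenceSubgroup.Gamma0_mem.mpr (by simp [ModularGroup.T])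
  · ext i j
    rw [Matrix.SpecialLinearGroup.map_apply_coe, ModularGroup.coe_T]
    fin_cases i <;> fin_cases j <;> simp [translation]

theorem fricke_mem (N : ℕ) [NeZero N] : fricke N ∈ gamma0Plus N :=
  Subgroup.subset_closure (.inr rfl)

/-- `χ(S) = -i`. -/
theorem chi_fricke : chi ⟨fricke 3, fricke_mem 3⟩ = -Complex.I := by
  change chiFun (fricke 3) = _
  rw [isType1_fricke.chiFun_eq, legendreSym.at_one]
  norm_num

/-- `χ(R) = -i`, where `R = T S`. -/
theorem chi_translation_mul_fricke :
    chi (⟨translation, translation_mem 3⟩ * ⟨fricke 3, fricke_mem 3⟩) = -Complex.I := by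
  have h : IsType0 translation 1 :=
    ⟨1, 0, 1, by norm_num, by simp [translation], by simp [translation], by simp [translation],
      by simp [translation]⟩
  rw [map_mul, chi_fricke]
  change chiFun translation * _ = _
  rw [h.chiFun_eq, legendreSym.at_one]
  norm_num

end QuasiMODE

/-! Put F = f and G = z f + h. The transformation law of the nearly holomorphic form says that the
column (G, F) is multiplied by χ(γ) j^(k-1) γ, where j = c z + d (`transform_components`). Let γ fix
z₀ and put j₀ = j(z₀). As γ is real, it also fixes conj z₀, and P = G - z₀ F and R = G - conj z₀ · F
are eigencombinations, with eigenvalues j₀⁻¹ and j₀ (`transform_eigen`).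

Let p and r be the orders of P and R at z₀. Since γ acts near z₀ with multiplier j₀⁻², comparing
leading terms gives j₀^(-2p) = χ(γ) j₀^(k-1) j₀⁻¹ and j₀^(-2r) = χ(γ) j₀^(k-1) j₀
(`multiplier_pow_order`). In the quotient the character and the weight cancel, and j₀^(2(p-r)) =
j₀². If j₀² has order e > 1, then p - r ≡ 1 mod e, so p ≠ r and p - r is prime to e.

On the other hand F/√W, P/√W and R/√W solve the same equation, and W is a constant multiple of the
Wronskian of P and R, hence of order p + r - 1. The exponents are therefore p - (p + r - 1)/2 and r
- (p + r - 1)/2, that is 1/2 ± (p - r)/2 (`hasLocalExponents_of_factor`). It remains to find the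
order of j₀² at each elliptic point. -/

namespace QuasiMODE

/-! ### Local analysis -/

/-- Complex conjugation is nowhere complex differentiable. -/
theorem not_differentiableAt_conj (z : ℂ) : ¬ DifferentiableAt ℂ (fun w : ℂ => conj w) z := by
  intro h
  have h1 := h.hasDerivAt.hasFDerivAt.restrictScalars ℝ
  have h2 : HasFDerivAt (fun w : ℂ => conj w) (Complex.conjCLE : ℂ →L[ℝ] ℂ) z :=
    Complex.conjCLE.hasFDerivAt
  -- A complex-linear map sending 1 to 1 sends I to I, whereas conjugation sends I to -I.
  have h3 := h1.unique h2
  have e1 := congrArg (fun L : ℂ →L[ℝ] ℂ => L 1) h3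
  have e2 := congrArg (fun L : ℂ →L[ℝ] ℂ => L Complex.I) h3
  simp at e1 e2
  rw [e1] at e2
  have := congrArg Complex.im e2
  norm_num at this

/-- Holomorphic functions `A`, `B` with `A (z - conj z) + B = 0` on an open set vanish there. -/
theorem eqOn_zero_of_mul_sub_conj_add {U : Set ℂ} (hU : IsOpen U) {A B : ℂ → ℂ}
    (hA : DifferentiableOn ℂ A U) (hB : DifferentiableOn ℂ B U)
    (h : ∀ z ∈ U, A z * (z - conj z) + B z = 0) {z : ℂ} (hz : z ∈ U) : A z = 0 := by
  by_contra h0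
  have hAz := hA.differentiableAt (hU.mem_nhds hz)
  have hBz := hB.differentiableAt (hU.mem_nhds hz)
  -- Where A ≠ 0, the relation reads conj w = w + B w / A w, which would make conjugation
  -- holomorphic.
  refine not_differentiableAt_conj z
    ((differentiableAt_id.add (hBz.div hAz h0)).congr_of_eventuallyEq ?_)
  filter_upwards [hU.mem_nhds hz, hAz.continuousAt.eventually_ne h0] with w hw hw0
  simp only [Pi.add_apply, Pi.div_apply, id]
  field_simp
  linear_combination -h w hw

/-- If `P` vanishes to order `p` at a fixed point of `φ` and `P ∘ φ = m P`, then the multiplier of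
the fixed point, raised to the power `p`, is the value of `m`. -/
theorem multiplier_pow_order {P P₁ φ m : ℂ → ℂ} {z₀ μ : ℂ} {p : ℕ} (hP₁ : ContinuousAt P₁ z₀)
    (h0 : P₁ z₀ ≠ 0) (hP : ∀ᶠ z in 𝓝 z₀, P z = (z - z₀) ^ p * P₁ z)
    (hφ : HasDerivAt φ μ z₀) (hfix : φ z₀ = z₀) (hm : ContinuousAt m z₀)
    (hrel : ∀ᶠ z in 𝓝 z₀, P (φ z) = m z * P z) : μ ^ p = m z₀ := by
  have hφc : Tendsto φ (𝓝 z₀) (𝓝 z₀) := by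
    have := hφ.continuousAt.tendsto
    rwa [hfix] at this
  -- Divide P(φ z) = m(z) P(z) by (z - z₀)^p: the left side becomes slope^p · P₁(φ z), and both
  -- sides have limits at z₀.
  have t1 : Tendsto (fun z => slope φ z₀ z ^ p * P₁ (φ z)) (𝓝[≠] z₀) (𝓝 (μ ^ p * P₁ z₀)) :=
    ((hasDerivAt_iff_tendsto_slope.mp hφ).pow p).mul
      ((hP₁.tendsto.comp hφc).mono_left nhdsWithin_le_nhds)
  have t2 : Tendsto (fun z => m z * P₁ z) (𝓝[≠] z₀) (𝓝 (m z₀ * P₁ z₀)) :=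
    (hm.tendsto.mul hP₁.tendsto).mono_left nhdsWithin_le_nhds
  have e : (fun z => slope φ z₀ z ^ p * P₁ (φ z)) =ᶠ[𝓝[≠] z₀] fun z => m z * P₁ z := by
    filter_upwards [hP.filter_mono nhdsWithin_le_nhds, hrel.filter_mono nhdsWithin_le_nhds,
      (hφc.eventually hP).filter_mono nhdsWithin_le_nhds, self_mem_nhdsWithin] with z h1 h2 h3 h4
    have h4 : z - z₀ ≠ 0 := sub_ne_zero.mpr h4
    rw [h3, h1] at h2
    rw [slope_def_field, hfix, div_pow]
    field_simp
    linear_combination h2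
  exact mul_right_cancel₀ h0 (tendsto_nhds_unique t1 (t2.congr' e.symm))

/-! ### Square roots of the Wronskian and the second-order equation -/

theorem sqrtBranch_sq {W : ℂ → ℂ} {z₀ z : ℂ} (h0 : W z₀ ≠ 0) : sqrtBranch W z₀ z ^ 2 = W z := by
  have h (x : ℂ) : (x ^ (1 / 2 : ℂ)) ^ 2 = x := by
    rw [← Complex.cpow_nat_mul]; norm_num
  rw [sqrtBranch, mul_pow, h, h]
  field_simp

/-- Dividing by W z₀ moves the base value to 1, away from the cut of the principal power. -/
theorem analyticAt_sqrtBranch {W : ℂ → ℂ} {z₀ : ℂ} (hW : AnalyticAt ℂ W z₀) (h0 : W z₀ ≠ 0) :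
    AnalyticAt ℂ (sqrtBranch W z₀) z₀ := by
  refine analyticAt_const.mul ((hW.div analyticAt_const h0).cpow analyticAt_const ?_)
  rw [Pi.div_apply, div_self h0]
  exact Complex.one_mem_slitPlane

/-- Two functions with constant Wronskian solve the same equation `y'' = q y`. -/
theorem mul_deriv_deriv_eq {y₁ y₂ : ℂ → ℂ} {w c : ℂ} (h₁ : AnalyticAt ℂ y₁ w)
    (h₂ : AnalyticAt ℂ y₂ w) (h : ∀ᶠ z in 𝓝 w, y₁ z * deriv y₂ z - deriv y₁ z * y₂ z = c) :
    y₁ w * deriv (deriv y₂) w = deriv (deriv y₁) w * y₂ w := by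
  have d : HasDerivAt (fun z => y₁ z * deriv y₂ z - deriv y₁ z * y₂ z)
      ((deriv y₁ w * deriv y₂ w + y₁ w * deriv (deriv y₂) w) -
        (deriv (deriv y₁) w * y₂ w + deriv y₁ w * deriv y₂ w)) w :=
    (h₁.differentiableAt.hasDerivAt.mul h₂.deriv.differentiableAt.hasDerivAt).sub
      (h₁.deriv.differentiableAt.hasDerivAt.mul h₂.differentiableAt.hasDerivAt)
  have e := d.unique ((hasDerivAt_const w c).congr_of_eventuallyEq h)
  linear_combination e

/-- If `y' / y = u` near `w`, then `y'' = (u' + u²) y`. -/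
theorem deriv_deriv_eq_of_logDeriv {y u : ℂ → ℂ} {w u' : ℂ} (hy : AnalyticAt ℂ y w) (h0 : y w ≠ 0)
    (hu : HasDerivAt u u' w) (h : ∀ᶠ z in 𝓝 w, logDeriv y z = u z) :
    deriv (deriv y) w = (u' + u w ^ 2) * y w := by
  have e : deriv y =ᶠ[𝓝 w] fun z => y z * u z := by
    filter_upwards [h, hy.continuousAt.eventually_ne h0] with z hz hz0
    rw [← hz, logDeriv_apply]
    field_simp
  have d := (hy.differentiableAt.hasDerivAt.mul hu).congr_of_eventuallyEq e
  rw [d.deriv, e.self_of_nhds]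
  ring

theorem logDeriv_eq_of_pow_mul {f f₁ : ℂ → ℂ} {z₀ z : ℂ} {n : ℕ}
    (h : ∀ᶠ w in 𝓝 z, f w = (w - z₀) ^ n * f₁ w) (hz : z ≠ z₀) (hf₁ : DifferentiableAt ℂ f₁ z)
    (h0 : f₁ z ≠ 0) : logDeriv f z = n / (z - z₀) + logDeriv f₁ z := by
  have hz' : z - z₀ ≠ 0 := sub_ne_zero.mpr hz
  rw [(logDeriv_congr_nhds h).self_of_nhds, logDeriv_mul (f := fun w => (w - z₀) ^ n) z (pow_ne_zero _ hz') h0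
    (by fun_prop) hf₁, logDeriv_fun_pow (f := fun w => w - z₀) (by fun_prop)]
  simp [logDeriv_apply, div_eq_mul_inv]

/-- Let `F`, `P` be holomorphic with `P F' - P' F = W`, and let `s` be a square root of `W`, near a
point where `F`, `P` and `W` do not vanish. Then `F / s` and `P / s` satisfy the same linear equation
`y'' = q y`, and `q = u' + u²` if `u = P' / P - W' / (2 W)`. -/
theorem deriv_deriv_div_sqrt {F P W s u : ℂ → ℂ} {w u' : ℂ} (hF : AnalyticAt ℂ F w)
    (hP : AnalyticAt ℂ P w) (hs : AnalyticAt ℂ s w) (hF0 : F w ≠ 0) (hP0 : P w ≠ 0)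
    (hs0 : s w ≠ 0) (hsW : ∀ᶠ z in 𝓝 w, s z ^ 2 = W z)
    (hW : ∀ᶠ z in 𝓝 w, P z * deriv F z - deriv P z * F z = W z) (hu : HasDerivAt u u' w)
    (h : ∀ᶠ z in 𝓝 w, logDeriv P z - logDeriv W z / 2 = u z) :
    deriv (deriv fun z => F z / s z) w / (F w / s w) = u' + u w ^ 2 := by
  have hy₁ : AnalyticAt ℂ (fun z => F z / s z) w := hF.div hs hs0
  have hy₂ : AnalyticAt ℂ (fun z => P z / s z) w := hP.div hs hs0
  have hsne := hs.continuousAt.eventually_ne hs0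
  -- Dividing both functions by s divides their Wronskian by s² = W; the sign comes from taking F
  -- before P.
  have hwr : ∀ᶠ z in 𝓝 w, (F z / s z) * deriv (fun z => P z / s z) z -
      deriv (fun z => F z / s z) z * (P z / s z) = -1 := by
    filter_upwards [hsne, hsW, hW, hF.eventually_analyticAt, hP.eventually_analyticAt,
      hs.eventually_analyticAt] with z h0 h1 h2 aF aP as
    rw [deriv_fun_div aP.differentiableAt as.differentiableAt h0,
      deriv_fun_div aF.differentiableAt as.differentiableAt h0]
    field_simp
    linear_combination s z * h1 - s z * h2
  -- From s² = W, the logarithmic derivative of s is half that of W.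
  have hlog : ∀ᶠ z in 𝓝 w, logDeriv (fun z => P z / s z) z = u z := by
    filter_upwards [hsne, hsW.eventually_nhds, h, hP.eventually_analyticAt,
      hs.eventually_analyticAt, hP.continuousAt.eventually_ne hP0] with z h0 h1 h2 aP as hp0
    rw [logDeriv_div z hp0 h0 aP.differentiableAt as.differentiableAt, ← h2,
      ← (logDeriv_congr_nhds h1).self_of_nhds, logDeriv_fun_pow as.differentiableAt]
    push_cast
    ring
  have e1 := mul_deriv_deriv_eq hy₁ hy₂ hwr
  have e2 := deriv_deriv_eq_of_logDeriv hy₂ (div_ne_zero hP0 hs0) hu hlog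
  rw [e2] at e1
  have hy0 : P w / s w ≠ 0 := div_ne_zero hP0 hs0
  rw [div_eq_iff (div_ne_zero hF0 hs0)]
  refine mul_right_cancel₀ hy0 ?_
  linear_combination -e1

/-- The Wronskian of functions of different orders `p`, `r` has order `p + r - 1`. -/
theorem exists_wronskian_factor {P P₁ R R₁ : ℂ → ℂ} {z₀ : ℂ} {p r : ℕ} (hpr : p ≠ r)
    (hP₁ : AnalyticAt ℂ P₁ z₀) (hP0 : P₁ z₀ ≠ 0)
    (hP : ∀ᶠ z in 𝓝 z₀, P z = (z - z₀) ^ p * P₁ z)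
    (hR₁ : AnalyticAt ℂ R₁ z₀) (hR0 : R₁ z₀ ≠ 0)
    (hR : ∀ᶠ z in 𝓝 z₀, R z = (z - z₀) ^ r * R₁ z) :
    ∃ K : ℂ → ℂ, AnalyticAt ℂ K z₀ ∧ K z₀ ≠ 0 ∧
      ∀ᶠ z in 𝓝 z₀, (z - z₀) * (P z * deriv R z - deriv P z * R z) = (z - z₀) ^ (p + r) * K z := by
  -- This is the Wronskian of (z - z₀)^p P₁ and (z - z₀)^r R₁ with (z - z₀)^(p+r-1) removed; its
  -- value at z₀ is (r - p) P₁ R₁. The extra factor z - z₀ in the identity avoids the exponents p -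
  -- 1, r - 1 and p + r - 1.
  refine ⟨fun z => ((r : ℂ) - p) * (P₁ z * R₁ z) +
    (z - z₀) * (P₁ z * deriv R₁ z - deriv P₁ z * R₁ z), ?_, ?_, ?_⟩
  · have := hP₁.deriv
    have := hR₁.deriv
    fun_prop
  · have : (r : ℂ) - p ≠ 0 := sub_ne_zero.mpr (by exact_mod_cast hpr.symm)
    simpa using ⟨this, hP0, hR0⟩
  · filter_upwards [hP.eventually_nhds, hR.eventually_nhds, hP₁.eventually_analyticAt,
      hR₁.eventually_analyticAt] with z h1 h2 a1 a2
    have key {f f₁ : ℂ → ℂ} {n : ℕ} (h : ∀ᶠ w in 𝓝 z, f w = (w - z₀) ^ n * f₁ w)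
        (a : AnalyticAt ℂ f₁ z) : (z - z₀) * deriv f z =
          (z - z₀) ^ n * (n * f₁ z + (z - z₀) * deriv f₁ z) := by
      have d : HasDerivAt (fun w => (w - z₀) ^ n * f₁ w) _ z :=
        ((((hasDerivAt_id z).sub_const z₀).pow n).mul a.differentiableAt.hasDerivAt)
      rw [(d.congr_of_eventuallyEq h).deriv]
      rcases n with _ | n
      · simp
      · simp only [Pi.pow_apply, id, Nat.add_sub_cancel]
        push_cast
        ring
    have k1 := key h1 a1
    have k2 := key h2 a2
    rw [mul_sub, mul_left_comm, ← mul_assoc (z - z₀), k1, k2, h1.self_of_nhds, h2.self_of_nhds]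
    ring

/-- Near a point `z₀`, let `W = G F' - G' F`, and let `P = G - α F`, `R = G - β F` have orders
`p ≠ r`. Then the equation satisfied by `F / √W` has local exponents `1/2 ± (p - r)/2` at `z₀`. -/
theorem hasLocalExponents_of_factor {F G P₁ R₁ Q W : ℂ → ℂ} {z₀ α β : ℂ} {p r : ℕ} (hpr : p ≠ r)
    (hαβ : α ≠ β) (hF : AnalyticAt ℂ F z₀) (hG : AnalyticAt ℂ G z₀)
    (hF0 : ¬ ∀ᶠ z in 𝓝 z₀, F z = 0)
    (hP₁ : AnalyticAt ℂ P₁ z₀) (hP0 : P₁ z₀ ≠ 0)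
    (hP : ∀ᶠ z in 𝓝 z₀, G z - α * F z = (z - z₀) ^ p * P₁ z)
    (hR₁ : AnalyticAt ℂ R₁ z₀) (hR0 : R₁ z₀ ≠ 0)
    (hR : ∀ᶠ z in 𝓝 z₀, G z - β * F z = (z - z₀) ^ r * R₁ z)
    (hW : ∀ᶠ z in 𝓝 z₀, W z = G z * deriv F z - deriv G z * F z)
    (hQ : ∀ᶠ z in 𝓝 z₀, Q z = -(1 / (4 * (Real.pi : ℂ) ^ 2)) *
      (deriv (deriv fun w => F w / sqrtBranch W z w) z / (F z / sqrtBranch W z z))) :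
    HasLocalExponents Q z₀ (1 / 2 + ((p : ℂ) - r) / 2) (1 / 2 - ((p : ℂ) - r) / 2) := by
  obtain ⟨K, hK, hK0, hKW⟩ := exists_wronskian_factor hpr hP₁ hP0 hP hR₁ hR0 hR
  set δ : ℂ := α - β with hδ
  have hδ0 : δ ≠ 0 := sub_ne_zero.mpr hαβ
  have hdP : ∀ c : ℂ, ∀ᶠ z in 𝓝 z₀,
      deriv (fun z => G z - c * F z) z = deriv G z - c * deriv F z := fun c => by
    filter_upwards [hF.eventually_analyticAt, hG.eventually_analyticAt] with z aF aG
    rw [deriv_fun_sub aG.differentiableAt (aF.differentiableAt.const_mul c),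
      deriv_const_mul _ aF.differentiableAt]
  -- By bilinearity the Wronskian of G - α F and G - β F is (α - β) W.
  have hWK : ∀ᶠ z in 𝓝 z₀, (z - z₀) * W z = (z - z₀) ^ (p + r) * (K z / δ) := by
    filter_upwards [hKW, hW, hdP α, hdP β] with z h1 h2 h3 h4
    rw [h3, h4] at h1
    rw [mul_div_assoc', ← h1, h2, eq_div_iff hδ0, hδ]
    ring
  -- Here a = p - (p + r - 1)/2 is the exponent of P/√W at z₀, and ε is the holomorphic part of its
  -- logarithmic derivative u = a/(z - z₀) + ε.
  set a : ℂ := 1 / 2 + ((p : ℂ) - r) / 2 with ha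
  set ε : ℂ → ℂ := fun z => logDeriv P₁ z - logDeriv K z / 2 with hε
  have aε : AnalyticAt ℂ ε z₀ :=
    (hP₁.deriv.div hP₁ hP0).sub ((hK.deriv.div hK hK0).div analyticAt_const two_ne_zero)
  have aW : AnalyticAt ℂ W z₀ := by
    refine AnalyticAt.congr ?_ (hW.mono fun z h => h.symm)
    have := hF.deriv
    have := hG.deriv
    fun_prop
  -- The bracket is u' + u² expanded in powers of z - z₀.
  set Q₁ : ℂ → ℂ := fun z => -(1 / (4 * (Real.pi : ℂ) ^ 2)) *
    ((a ^ 2 - a) / (z - z₀) ^ 2 + 2 * a * ε z / (z - z₀) + (deriv ε z + ε z ^ 2)) with hQ₁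
  have hFne : ∀ᶠ z in 𝓝[≠] z₀, F z ≠ 0 :=
    hF.eventually_eq_zero_or_eventually_ne_zero.resolve_left hF0
  have hQQ : Q =ᶠ[𝓝[≠] z₀] Q₁ := by
    have A := (hP.eventually_nhds.and (hWK.eventually_nhds.and (hW.eventually_nhds.and
      (hQ.and ((hdP α).eventually_nhds))))).filter_mono (nhdsWithin_le_nhds (s := {z₀}ᶜ))
    have B := (hP₁.eventually_analyticAt.and (hK.eventually_analyticAt.and
      (aε.eventually_analyticAt.and (aW.eventually_analyticAt.and
      (hF.eventually_analyticAt.and hG.eventually_analyticAt))))).filter_mono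
        (nhdsWithin_le_nhds (s := {z₀}ᶜ))
    have C := ((hP₁.continuousAt.eventually_ne hP0).and
      (hK.continuousAt.eventually_ne hK0)).filter_mono (nhdsWithin_le_nhds (s := {z₀}ᶜ))
    -- In `hQ` the root is based at the moving point z, so Q is computed separately at each nearby z
    -- ≠ z₀, where F, P and W do not vanish.
    filter_upwards [A, B, C, hFne, self_mem_nhdsWithin] with z ⟨eP, eWK, eW, eQ, edP⟩
      ⟨aP₁, aK, aεz, aWz, aF, aG⟩ ⟨nP, nK⟩ nF hz
    have hz : z ≠ z₀ := hz
    have hz' : z - z₀ ≠ 0 := sub_ne_zero.mpr hz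
    have hWz : W z ≠ 0 := by
      intro h
      have := eWK.self_of_nhds
      rw [h, mul_zero] at this
      exact mul_ne_zero (pow_ne_zero _ hz') (div_ne_zero nK hδ0) this.symm
    have hPz : G z - α * F z ≠ 0 := by
      rw [eP.self_of_nhds]
      exact mul_ne_zero (pow_ne_zero _ hz') nP
    have hsz : sqrtBranch W z z ≠ 0 := by
      intro h
      have := sqrtBranch_sq (z := z) hWz
      rw [h] at this
      exact hWz (by simpa using this.symm)
    have hu : HasDerivAt (fun w => a / (w - z₀) + ε w) (-a / (z - z₀) ^ 2 + deriv ε z) z := by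
      have h1 : HasDerivAt (fun w => a / (w - z₀)) (-a / (z - z₀) ^ 2) z := by
        simpa [Pi.div_def] using (hasDerivAt_const z a).div ((hasDerivAt_id z).sub_const z₀) hz'
      exact h1.add aεz.differentiableAt.hasDerivAt
    have hlog : ∀ᶠ w in 𝓝 z, logDeriv (fun z => G z - α * F z) w - logDeriv W w / 2 =
        a / (w - z₀) + ε w := by
      filter_upwards [eP.eventually_nhds, eWK.eventually_nhds, aP₁.eventually_analyticAt,
        aK.eventually_analyticAt, aP₁.continuousAt.eventually_ne nP,
        aK.continuousAt.eventually_ne nK, isOpen_ne.mem_nhds hz, aWz.eventually_analyticAt,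
        aWz.continuousAt.eventually_ne hWz] with w fP fWK bP bK mP mK hw bW mW
      have hw' : w - z₀ ≠ 0 := sub_ne_zero.mpr hw
      have l1 := logDeriv_eq_of_pow_mul fP hw bP.differentiableAt mP
      have l2 := logDeriv_eq_of_pow_mul fWK hw
        (bK.differentiableAt.div_const δ) (div_ne_zero mK hδ0)
      rw [logDeriv_mul (f := fun w => w - z₀) w hw' mW (by fun_prop) bW.differentiableAt] at l2
      have l3 : logDeriv (fun z => K z / δ) w = logDeriv K w := by
        simp_rw [div_eq_mul_inv]
        exact logDeriv_mul_const w _ (inv_ne_zero hδ0)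
      have l4 : logDeriv (fun w => w - z₀) w = 1 / (w - z₀) := by
        simp [logDeriv_apply]
      rw [l3, l4] at l2
      have l5 : logDeriv W w = ((p : ℂ) + r - 1) / (w - z₀) + logDeriv K w := by
        push_cast at l2
        linear_combination l2
      rw [l1, l5, hε, ha]
      ring
    have hwr : ∀ᶠ w in 𝓝 z, (G w - α * F w) * deriv F w -
        deriv (fun z => G z - α * F z) w * F w = W w := by
      filter_upwards [eW, edP] with w h1 h2
      rw [h1, h2]
      ring
    rw [eQ, deriv_deriv_div_sqrt (P := fun z => G z - α * F z) aF (aG.sub (analyticAt_const.mul aF))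
      (analyticAt_sqrtBranch aWz hWz) nF hPz hsz (.of_forall fun w => sqrtBranch_sq hWz) hwr hu hlog,
      hQ₁]
    field_simp
    ring
  have aε' := aε.deriv
  refine ⟨?_, -(1 / (4 * (Real.pi : ℂ) ^ 2)) * (a ^ 2 - a), ?_, ?_⟩
  · refine MeromorphicAt.congr ?_ hQQ.symm
    have := aε.meromorphicAt
    have := aε'.meromorphicAt
    fun_prop
  · have t : Tendsto (fun z => -(1 / (4 * (Real.pi : ℂ) ^ 2)) *
        ((a ^ 2 - a) + 2 * a * ε z * (z - z₀) + (deriv ε z + ε z ^ 2) * (z - z₀) ^ 2)) (𝓝[≠] z₀)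
        (𝓝 (-(1 / (4 * (Real.pi : ℂ) ^ 2)) * (a ^ 2 - a))) := by
      have hc : ContinuousAt (fun z => -(1 / (4 * (Real.pi : ℂ) ^ 2)) *
        ((a ^ 2 - a) + 2 * a * ε z * (z - z₀) + (deriv ε z + ε z ^ 2) * (z - z₀) ^ 2)) z₀ := by
        have := aε.continuousAt
        have := aε'.continuousAt
        fun_prop
      simpa using hc.tendsto.mono_left nhdsWithin_le_nhds
    refine t.congr' ?_
    filter_upwards [hQQ, self_mem_nhdsWithin] with z h hz
    have hz' : z - z₀ ≠ 0 := sub_ne_zero.mpr hz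
    rw [h, hQ₁]
    field_simp
  · intro x
    have hpi : (Real.pi : ℂ) ≠ 0 := by exact_mod_cast Real.pi_ne_zero
    rw [ha]
    field_simp
    ring

/-! ### Transformation of the components of a quasimodular form -/

theorem HasLocalExponents.symm {Q : ℂ → ℂ} {z₀ r₁ r₂ : ℂ} (h : HasLocalExponents Q z₀ r₁ r₂) :
    HasLocalExponents Q z₀ r₂ r₁ := by
  obtain ⟨hm, A, hA, hr⟩ := h
  exact ⟨hm, A, hA, fun r => by rw [hr, mul_comm]⟩

theorem coe_smul (g : SL(2, ℝ)) (z : ℍ) : ((g • z : ℍ) : ℂ) =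
    ((g 0 0 : ℝ) * (z : ℂ) + (g 0 1 : ℝ)) / ((g 1 0 : ℝ) * (z : ℂ) + (g 1 1 : ℝ)) := by
  rw [coe_specialLinearGroup_apply]
  rfl

theorem automorphy_ne_zero (g : SL(2, ℝ)) (z : ℍ) :
    ((g 1 0 : ℝ) * (z : ℂ) + (g 1 1 : ℝ) : ℂ) ≠ 0 := by
  simpa [denom] using denom_ne_zero (g : GL (Fin 2) ℝ) z

theorem det_coe (g : SL(2, ℝ)) :
    ((g 0 0 : ℝ) * (g 1 1 : ℝ) - (g 0 1 : ℝ) * (g 1 0 : ℝ) : ℂ) = 1 := by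
  have := g.det_coe
  rw [Matrix.det_fin_two] at this
  exact_mod_cast this

theorem ofComplex_moebius (g : SL(2, ℝ)) {z : ℂ} (hz : 0 < z.im) :
    ofComplex (((g 0 0 : ℝ) * z + (g 0 1 : ℝ)) / ((g 1 0 : ℝ) * z + (g 1 1 : ℝ))) =
      g • ofComplex z := by
  have h := coe_smul g ⟨z, hz⟩
  rw [ofComplex_apply_of_im_pos hz, ← ofComplex_apply (g • _), h]

theorem differentiableOn_comp_moebius (g : SL(2, ℝ)) {f : ℍ → ℂ}
    (hf : DifferentiableOn ℂ (f ∘ ofComplex) {z | 0 < z.im}) :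
    DifferentiableOn ℂ (fun z => f (g • ofComplex z)) {z | 0 < z.im} := by
  have hσ : DifferentiableOn ℂ (fun z : ℂ =>
      ((g 0 0 : ℝ) * z + (g 0 1 : ℝ)) / ((g 1 0 : ℝ) * z + (g 1 1 : ℝ))) {z | 0 < z.im} := by
    refine DifferentiableOn.div (by fun_prop) (by fun_prop) fun z hz => ?_
    exact automorphy_ne_zero g ⟨z, hz⟩
  refine (hf.comp hσ fun z hz => ?_).congr fun z hz => ?_
  · change 0 < Complex.im _
    have h := coe_smul g ⟨z, hz⟩
    rw [← h]
    exact (g • (⟨z, hz⟩ : ℍ)).im_pos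
  · simp only [Function.comp_apply]
    rw [ofComplex_moebius g hz]

section

variable {Γ : Subgroup SL(2, ℝ)} {χ : Γ →* ℂ} {k : ℤ} {f h : ℍ → ℂ}

/-- Multiply the transformation law by z - conj z, using γz - conj(γz) = (z - conj z)/(j · conj j)
and conj j = j - c (z - conj z). The result has the form A (z - conj z) + B = 0 with A and B
holomorphic, so A = 0, and then B = 0. Thus h has weight k - 2, and the failure of f to be modular
is measured by c h. -/
theorem IsQuasimodular.transform_components (hq : IsQuasimodular Γ χ k f h) (γ : Γ) (z : ℍ) :
    f ((γ : SL(2, ℝ)) • z) =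
      χ γ * (((γ : SL(2, ℝ)) 1 0 : ℝ) * (z : ℂ) + ((γ : SL(2, ℝ)) 1 1 : ℝ)) ^ (k - 1) *
        ((((γ : SL(2, ℝ)) 1 0 : ℝ) * (z : ℂ) + ((γ : SL(2, ℝ)) 1 1 : ℝ)) * f z +
          ((γ : SL(2, ℝ)) 1 0 : ℝ) * h z) ∧
    (((γ : SL(2, ℝ)) 1 0 : ℝ) * (z : ℂ) + ((γ : SL(2, ℝ)) 1 1 : ℝ)) * h ((γ : SL(2, ℝ)) • z) =
      χ γ * (((γ : SL(2, ℝ)) 1 0 : ℝ) * (z : ℂ) + ((γ : SL(2, ℝ)) 1 1 : ℝ)) ^ (k - 1) * h z := by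
  set g : SL(2, ℝ) := (γ : SL(2, ℝ)) with hg
  have hf := UpperHalfPlane.mdifferentiable_iff.mp hq.holo
  have hh := UpperHalfPlane.mdifferentiable_iff.mp hq.holo_coeff
  set j : ℂ → ℂ := fun w => (g 1 0 : ℝ) * w + (g 1 1 : ℝ) with hj
  have hj0 (w : ℍ) : j w ≠ 0 := automorphy_ne_zero g w
  have hjU (w : ℂ) (hw : w ∈ {z : ℂ | 0 < z.im}) : j w ≠ 0 := hj0 ⟨w, hw⟩
  have dj : DifferentiableOn ℂ j {z | 0 < z.im} := by fun_prop
  have djk : DifferentiableOn ℂ (fun w => j w ^ k) {z | 0 < z.im} := fun w hw =>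
    (dj w hw).zpow (.inl (hjU w hw))
  have dA : DifferentiableOn ℂ (fun w => f (g • ofComplex w) -
      (g 1 0 : ℝ) * j w * h (g • ofComplex w) - χ γ * j w ^ k * (f ∘ ofComplex) w)
      {z | 0 < z.im} :=
    ((differentiableOn_comp_moebius g hf).sub
      ((dj.const_mul _).mul (differentiableOn_comp_moebius g hh))).sub ((djk.const_mul _).mul hf)
  have dB : DifferentiableOn ℂ (fun w => j w ^ 2 * h (g • ofComplex w) -
      χ γ * j w ^ k * (h ∘ ofComplex) w) {z | 0 < z.im} :=
    ((dj.pow 2).mul (differentiableOn_comp_moebius g hh)).sub ((djk.const_mul _).mul hh)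
  have hAB : ∀ w : ℍ, (f (g • w) - (g 1 0 : ℝ) * j w * h (g • w) - χ γ * j w ^ k * f w) *
      ((w : ℂ) - conj (w : ℂ)) + (j w ^ 2 * h (g • w) - χ γ * j w ^ k * h w) = 0 := by
    intro w
    have t := hq.transform γ w
    rw [← hg] at t
    change _ = χ γ * j w ^ k * _ at t
    have hw : (w : ℂ) - conj (w : ℂ) ≠ 0 := by
      rw [Complex.sub_conj]
      have : w.im ≠ 0 := w.im_pos.ne'
      simpa using this
    have hjc : conj (j w) ≠ 0 := by simpa using hj0 w
    have hjc' : conj (j w) = (g 1 0 : ℝ) * conj (w : ℂ) + (g 1 1 : ℝ) := by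
      simp [hj]
    have hd := det_coe g
    have hs : ((g • w : ℍ) : ℂ) - conj ((g • w : ℍ) : ℂ) =
        ((w : ℂ) - conj (w : ℂ)) / (j w * conj (j w)) := by
      rw [coe_smul, map_div₀]
      change _ / j w - _ / conj (j w) = _
      rw [div_sub_div _ _ (hj0 w) hjc, hjc']
      congr 1
      simp only [hj, map_add, map_mul, Complex.conj_ofReal]
      linear_combination ((w : ℂ) - conj (w : ℂ)) * hd
    rw [nearlyHolomorphic, nearlyHolomorphic, hs, div_div_eq_mul_div, hjc'] at t
    field_simp at t
    simp only [hj] at t ⊢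
    linear_combination t
  have hA := eqOn_zero_of_mul_sub_conj_add (isOpen_lt continuous_const Complex.continuous_im) dA dB
    (fun w hw => by simpa [ofComplex_apply_of_im_pos hw] using hAB ⟨w, hw⟩) z.im_pos
  have hB := hAB z
  simp only [Function.comp_apply, ofComplex_apply] at hA
  rw [hA, zero_mul, zero_add] at hB
  have hjz := hj0 z
  have hk : j z ^ k = j z ^ (k - 1) * j z := by
    rw [← zpow_add_one₀ hjz, sub_add_cancel]
  change f (g • z) = χ γ * j z ^ (k - 1) * (j z * f z + (g 1 0 : ℝ) * h z) ∧
    j z * h (g • z) = χ γ * j z ^ (k - 1) * h z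
  have hB' : j z * h (g • z) = χ γ * j z ^ (k - 1) * h z := by
    refine mul_left_cancel₀ hjz ?_
    rw [hk] at hB
    linear_combination hB
  refine ⟨?_, hB'⟩
  rw [hk] at hA
  linear_combination hA + (g 1 0 : ℝ) * hB'

/-- The values of a character are nonzero. -/
theorem character_ne_zero (χ : Γ →* ℂ) (γ : Γ) : χ γ ≠ 0 :=
  ((Group.isUnit γ).map χ).ne_zero

/-- If `α` is a fixed point of `γ`, then `z f + h - α f` is transformed to a multiple of itself. -/
theorem IsQuasimodular.transform_eigen (hq : IsQuasimodular Γ χ k f h) (γ : Γ) {α : ℂ}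
    (hα : ((γ : SL(2, ℝ)) 1 0 : ℝ) * α ^ 2 +
      (((γ : SL(2, ℝ)) 1 1 : ℝ) - ((γ : SL(2, ℝ)) 0 0 : ℝ)) * α - ((γ : SL(2, ℝ)) 0 1 : ℝ) = 0)
    (z : ℍ) :
    (((γ : SL(2, ℝ)) • z : ℍ) : ℂ) * f ((γ : SL(2, ℝ)) • z) + h ((γ : SL(2, ℝ)) • z) -
        α * f ((γ : SL(2, ℝ)) • z) =
      χ γ * (((γ : SL(2, ℝ)) 1 0 : ℝ) * (z : ℂ) + ((γ : SL(2, ℝ)) 1 1 : ℝ)) ^ (k - 1) *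
        (((γ : SL(2, ℝ)) 0 0 : ℝ) - ((γ : SL(2, ℝ)) 1 0 : ℝ) * α) *
        ((z : ℂ) * f z + h z - α * f z) := by
  -- The fixed-point equation says that (1, -α) is a left eigenvector of γ with eigenvalue a - c α.
  obtain ⟨t1, t2⟩ := hq.transform_components γ z
  have hd := det_coe (γ : SL(2, ℝ))
  have hj0 := automorphy_ne_zero (γ : SL(2, ℝ)) z
  rw [coe_smul]
  set a : ℂ := (((γ : SL(2, ℝ)) 0 0 : ℝ) : ℂ)
  set b : ℂ := (((γ : SL(2, ℝ)) 0 1 : ℝ) : ℂ)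
  set c : ℂ := (((γ : SL(2, ℝ)) 1 0 : ℝ) : ℂ)
  set d : ℂ := (((γ : SL(2, ℝ)) 1 1 : ℝ) : ℂ)
  set X := χ γ * (c * (z : ℂ) + d) ^ (k - 1)
  refine mul_left_cancel₀ hj0 ?_
  rw [t1]
  have e : (c * (z : ℂ) + d) * ((a * z + b) / (c * z + d)) = a * z + b := by field_simp
  linear_combination (X * ((c * z + d) * f z + c * h z)) * e + t2 -
    X * (c * z + d) * f z * hα - X * h z * hd

/-! ### Nonvanishing in depth one -/

theorem isPreconnected_im_pos : IsPreconnected {z : ℂ | 0 < z.im} :=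
  (convex_halfSpace_im_gt 0).isPreconnected

theorem IsQuasimodular.analyticOnNhd (hq : IsQuasimodular Γ χ k f h) :
    AnalyticOnNhd ℂ (fun z => f (ofComplex z)) {z | 0 < z.im} ∧
      AnalyticOnNhd ℂ (fun z => z * f (ofComplex z) + h (ofComplex z)) {z | 0 < z.im} := by
  have hU : IsOpen {z : ℂ | 0 < z.im} := isOpen_lt continuous_const Complex.continuous_im
  have hf := (UpperHalfPlane.mdifferentiable_iff.mp hq.holo).analyticOnNhd hU
  have hh := (UpperHalfPlane.mdifferentiable_iff.mp hq.holo_coeff).analyticOnNhd hU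
  exact ⟨hf, fun z hz => (analyticAt_id.mul (hf z hz)).add (hh z hz)⟩

/-- If the depth is not `0`, then `f` does not vanish identically. -/
theorem IsQuasimodular.not_eventually_eq_zero (hq : IsQuasimodular Γ χ k f h) (h0 : h ≠ 0) {γ : Γ}
    (hc : (γ : SL(2, ℝ)) 1 0 ≠ 0) {z₀ : ℂ} (hz₀ : 0 < z₀.im) :
    ¬ ∀ᶠ z in 𝓝 z₀, f (ofComplex z) = 0 := by
  intro hev
  have hf : ∀ z : ℍ, f z = 0 := fun z => by
    have := hq.analyticOnNhd.1.eqOn_zero_of_preconnected_of_eventuallyEq_zero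
      isPreconnected_im_pos hz₀ hev z.im_pos
    simpa using this
  refine h0 (funext fun z => ?_)
  have t := (hq.transform_components γ z).1
  -- With f = 0, the law for f leaves χ(γ) j^(k-1) c h = 0.
  rw [hf, hf, mul_zero, zero_add] at t
  have h1 := character_ne_zero χ γ
  have h2 := zpow_ne_zero (k - 1) (automorphy_ne_zero (γ : SL(2, ℝ)) z)
  have h3 : (((γ : SL(2, ℝ)) 1 0 : ℝ) : ℂ) ≠ 0 := by exact_mod_cast hc
  exact (mul_eq_zero.mp ((mul_eq_zero.mp t.symm).resolve_left (mul_ne_zero h1 h2))).resolve_left h3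

/-- If the depth is not `0`, then `z f + h` is not a constant multiple of `f`. -/
theorem IsQuasimodular.not_eventually_eq_mul (hq : IsQuasimodular Γ χ k f h) (h0 : h ≠ 0) {γ : Γ}
    (hc : (γ : SL(2, ℝ)) 1 0 ≠ 0) (hT : translation ∈ Γ) {z₀ : ℂ} (hz₀ : 0 < z₀.im) (α : ℂ) :
    ¬ ∀ᶠ z in 𝓝 z₀, z * f (ofComplex z) + h (ofComplex z) - α * f (ofComplex z) = 0 := by
  intro hev
  obtain ⟨aF, aG⟩ := hq.analyticOnNhd
  have hG : ∀ z : ℍ, (z : ℂ) * f z + h z - α * f z = 0 := fun z => by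
    have := AnalyticOnNhd.eqOn_zero_of_preconnected_of_eventuallyEq_zero
      (fun z hz => (aG z hz).sub (analyticAt_const.mul (aF z hz)))
      isPreconnected_im_pos hz₀ hev z.im_pos
    simpa using this
  refine hq.not_eventually_eq_zero h0 hc hz₀ (.of_forall fun w => ?_)
  generalize ofComplex w = z
  obtain ⟨t1, t2⟩ := hq.transform_components ⟨translation, hT⟩ z
  have e1 := hG z
  -- Under z ↦ z + 1, up to the character, F is fixed and G becomes G + F; so G = α F at both points
  -- forces F = 0.
  have e2 := hG (translation • z)
  have hX := character_ne_zero χ ⟨translation, hT⟩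
  rw [coe_smul] at e2
  generalize χ ⟨translation, hT⟩ = X at hX t1 t2
  simp [translation] at t1 t2 e2
  rw [t1, t2] at e2
  refine (mul_eq_zero.mp ?_).resolve_left hX
  linear_combination e2 - X * e1

theorem wronskian_eq (f h : ℍ → ℂ) (z : ℂ) : wronskian f h z =
    (z * f (ofComplex z) + h (ofComplex z)) * deriv (fun w : ℂ => f (ofComplex w)) z -
      deriv (fun w : ℂ => w * f (ofComplex w) + h (ofComplex w)) z * f (ofComplex z) := by
  rw [wronskian, Matrix.det_fin_two_of]

/-- The local exponents at an elliptic point whose automorphy factor has a square of order `e`. -/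
theorem IsQuasimodular.exponentsCoprime (hq : IsQuasimodular Γ χ k f h) (h0 : h ≠ 0)
    (hT : translation ∈ Γ) {γ : SL(2, ℝ)} (hγ : γ ∈ Γ) (hc : γ 1 0 ≠ 0) {z₀ : ℂ} (hz₀ : 0 < z₀.im)
    (hfix : (γ 1 0 : ℝ) * z₀ ^ 2 + ((γ 1 1 : ℝ) - (γ 0 0 : ℝ)) * z₀ - (γ 0 1 : ℝ) = 0)
    {e : ℕ} (he : 1 < e) (hprim : IsPrimitiveRoot (((γ 1 0 : ℝ) * z₀ + (γ 1 1 : ℝ) : ℂ) ^ 2) e) :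
    ExponentsCoprime (potential f h) z₀ e := by
  obtain ⟨aF, aG⟩ := hq.analyticOnNhd
  have hU : IsOpen {z : ℂ | 0 < z.im} := isOpen_lt continuous_const Complex.continuous_im
  have hUm : ∀ᶠ z in 𝓝 z₀, 0 < z.im := hU.mem_nhds hz₀
  have hfix' : (γ 1 0 : ℝ) * conj z₀ ^ 2 + ((γ 1 1 : ℝ) - (γ 0 0 : ℝ)) * conj z₀ - (γ 0 1 : ℝ) =
      (0 : ℂ) := by
    have := congrArg conj hfix
    simpa using this
  have hne : z₀ ≠ conj z₀ := by
    intro hh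
    have := congrArg Complex.im hh
    rw [Complex.conj_im] at this
    linarith
  have hd := det_coe γ
  set σ : ℂ → ℂ := fun z =>
    ((γ 0 0 : ℝ) * z + (γ 0 1 : ℝ)) / ((γ 1 0 : ℝ) * z + (γ 1 1 : ℝ)) with hσ
  set j₀ : ℂ := (γ 1 0 : ℝ) * z₀ + (γ 1 1 : ℝ) with hj₀
  have hj0 : j₀ ≠ 0 := automorphy_ne_zero γ ⟨z₀, hz₀⟩
  -- The eigenvalues a - c α of γ: j₀ for α = conj z₀, by the sum of the two fixed points, and j₀⁻¹
  -- for α = z₀, by the determinant.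
  have htr : (γ 0 0 : ℝ) - (γ 1 0 : ℝ) * conj z₀ = j₀ := by
    refine mul_left_cancel₀ (sub_ne_zero.mpr hne) ?_
    rw [hj₀]
    linear_combination hfix' - hfix
  have hinv : ((γ 0 0 : ℝ) - (γ 1 0 : ℝ) * z₀) * j₀ = 1 := by
    rw [hj₀]
    linear_combination hd - (γ 1 0 : ℝ) * hfix
  have hσfix : σ z₀ = z₀ := by
    rw [hσ]
    simp only
    rw [div_eq_iff hj0]
    linear_combination -hfix
  have hσd : HasDerivAt σ ((j₀ ^ 2)⁻¹) z₀ := by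
    have h1 : HasDerivAt (fun z : ℂ => (γ 0 0 : ℝ) * z + (γ 0 1 : ℝ)) ((γ 0 0 : ℝ) * 1 : ℂ) z₀ :=
      ((hasDerivAt_id z₀).const_mul _).add_const _
    have h2 : HasDerivAt (fun z : ℂ => (γ 1 0 : ℝ) * z + (γ 1 1 : ℝ)) ((γ 1 0 : ℝ) * 1 : ℂ) z₀ :=
      ((hasDerivAt_id z₀).const_mul _).add_const _
    refine (h1.div h2 hj0).congr_deriv ?_
    rw [← hj₀, inv_eq_one_div, eq_comm]
    congr 1
    rw [hj₀]
    linear_combination -hd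
  have hfactor (α : ℂ)
      (hα : (γ 1 0 : ℝ) * α ^ 2 + ((γ 1 1 : ℝ) - (γ 0 0 : ℝ)) * α - (γ 0 1 : ℝ) = 0) :
      ∃ (n : ℕ) (P₁ : ℂ → ℂ), AnalyticAt ℂ P₁ z₀ ∧ P₁ z₀ ≠ 0 ∧
        (∀ᶠ z in 𝓝 z₀, z * f (ofComplex z) + h (ofComplex z) - α * f (ofComplex z) =
          (z - z₀) ^ n * P₁ z) ∧
        ((j₀ ^ 2)⁻¹) ^ n =
          χ ⟨γ, hγ⟩ * j₀ ^ (k - 1) * ((γ 0 0 : ℝ) - (γ 1 0 : ℝ) * α) := by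
    obtain ⟨n, P₁, hP₁, hP0, hP⟩ :=
      ((aG z₀ hz₀).fun_sub (analyticAt_const.fun_mul
        (aF z₀ hz₀))).exists_eventuallyEq_pow_smul_nonzero_iff.mpr
      (hq.not_eventually_eq_mul h0 (γ := ⟨γ, hγ⟩) hc hT hz₀ α)
    simp only [smul_eq_mul] at hP
    refine ⟨n, P₁, hP₁, hP0, hP, ?_⟩
    refine multiplier_pow_order
      (m := fun z => χ ⟨γ, hγ⟩ * ((γ 1 0 : ℝ) * z + (γ 1 1 : ℝ)) ^ (k - 1) *
        ((γ 0 0 : ℝ) - (γ 1 0 : ℝ) * α)) hP₁.continuousAt hP0 hP hσd hσfix ?_ ?_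
    · have : ContinuousAt (fun z : ℂ => (γ 1 0 : ℝ) * z + (γ 1 1 : ℝ)) z₀ := by fun_prop
      exact (continuousAt_const.mul (this.zpow₀ _ (.inl hj0))).mul continuousAt_const
    · filter_upwards [hUm] with z hz
      have t := hq.transform_eigen ⟨γ, hγ⟩ hα ⟨z, hz⟩
      rw [coe_smul] at t
      rw [ofComplex_moebius γ hz, ofComplex_apply_of_im_pos hz]
      exact t
  obtain ⟨p, P₁, hP₁, hP0, hP, hp⟩ := hfactor z₀ hfix
  obtain ⟨r, R₁, hR₁, hR0, hR, hr⟩ := hfactor (conj z₀) hfix'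
  -- Dividing `hp` by `hr` eliminates χ(γ) j₀^(k-1) and leaves (j₀²)^(p-r) = j₀².
  have hdvd : (e : ℤ) ∣ (p : ℤ) - r - 1 := by
    rw [← hprim.zpow_eq_one_iff_dvd]
    have hζ : j₀ ^ 2 ≠ 0 := pow_ne_zero _ hj0
    rw [zpow_sub₀ hζ, zpow_sub₀ hζ, zpow_natCast, zpow_natCast, zpow_one]
    rw [htr] at hr
    rw [inv_pow] at hp hr
    have hp' : ((j₀ ^ 2) ^ p)⁻¹ * j₀ = χ ⟨γ, hγ⟩ * j₀ ^ (k - 1) := by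
      rw [hp, mul_assoc, hinv, mul_one]
    rw [← hp'] at hr
    have e1 : (j₀ ^ 2) ^ p = (j₀ ^ 2) ^ r * j₀ ^ 2 := by
      field_simp at hr
      linear_combination hr
    rw [e1]
    field_simp
  have hpr : p ≠ r := by
    rintro rfl
    rw [sub_self, zero_sub, dvd_neg] at hdvd
    have := Int.le_of_dvd one_pos hdvd
    omega
  have hloc : HasLocalExponents (potential f h) z₀ (1 / 2 + ((p : ℂ) - r) / 2)
      (1 / 2 - ((p : ℂ) - r) / 2) :=
    hasLocalExponents_of_factor hpr hne (aF z₀ hz₀) (aG z₀ hz₀)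
      (hq.not_eventually_eq_zero h0 (γ := ⟨γ, hγ⟩) hc hz₀) hP₁ hP0 hP hR₁ hR0 hR
      (.of_forall (wronskian_eq f h)) (.of_forall fun z => rfl)
  -- The sign of p - r is not known; the opposite sign only interchanges the two exponents.
  refine ⟨((p : ℤ) - r).natAbs, by omega, ?_, ?_⟩
  · rcases le_total r p with hle | hle
    · have : ((((p : ℤ) - r).natAbs : ℕ) : ℂ) = (p : ℂ) - r := by
        rw [show ((p : ℤ) - r).natAbs = p - r by omega, Nat.cast_sub hle]
      rwa [this]
    · have : ((((p : ℤ) - r).natAbs : ℕ) : ℂ) = -((p : ℂ) - r) := by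
        rw [show ((p : ℤ) - r).natAbs = r - p by omega, Nat.cast_sub hle]
        ring
      rw [this, neg_div, ← sub_eq_add_neg, sub_neg_eq_add]
      exact hloc.symm
  · obtain ⟨t, ht⟩ := hdvd
    have : IsCoprime ((p : ℤ) - r) (e : ℤ) := ⟨1, -t, by linear_combination ht⟩
    exact Int.isCoprime_iff_gcd_eq_one.mp this

end

/-! ### The elliptic points -/

theorem ofReal_sqrt_sq {x : ℝ} (hx : 0 ≤ x) : ((√x : ℝ) : ℂ) ^ 2 = (x : ℂ) := by
  exact_mod_cast Real.sq_sqrt hx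

theorem isPrimitiveRoot_neg_one : IsPrimitiveRoot (-1 : ℂ) 2 :=
  IsPrimitiveRoot.mk_of_lt _ (by norm_num) (by norm_num) fun l h1 h2 => by
    interval_cases l; norm_num

theorem isPrimitiveRoot_I : IsPrimitiveRoot Complex.I 4 :=
  IsPrimitiveRoot.mk_of_lt _ (by norm_num) Complex.I_pow_four fun l h1 h2 => by
    interval_cases l <;> norm_num [Complex.ext_iff, pow_succ]

/-- A root of `x² + x + 1` is a primitive third root of unity. -/
theorem isPrimitiveRoot_three {ζ : ℂ} (h : ζ ^ 2 + ζ + 1 = 0) : IsPrimitiveRoot ζ 3 := by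
  refine IsPrimitiveRoot.mk_of_lt _ (by norm_num) (by linear_combination (ζ - 1) * h)
    fun l h1 h2 h3 => ?_
  interval_cases l
  · rw [pow_one] at h3
    rw [h3] at h
    norm_num at h
  · have : ζ = -2 := by linear_combination h - h3
    rw [this] at h
    norm_num at h

/-- A root of `x² - x + 1` is a primitive sixth root of unity. -/
theorem isPrimitiveRoot_six {ζ : ℂ} (h : ζ ^ 2 - ζ + 1 = 0) : IsPrimitiveRoot ζ 6 := by
  have h3 : ζ ^ 3 = -1 := by linear_combination (ζ + 1) * h
  refine IsPrimitiveRoot.mk_of_lt _ (by norm_num) (by linear_combination (ζ ^ 3 - 1) * h3)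
    fun l h1 h2 hl => ?_
  -- Using ζ² = ζ - 1 and ζ³ = -1, each equation ζ^l = 1 with l ≠ 3 determines ζ as an integer that
  -- is not a root of x² - x + 1.
  have key (x : ℂ) (hx : ζ = x) (hne : x ^ 2 - x + 1 ≠ 0) : False := hne (hx ▸ h)
  interval_cases l
  · exact key 1 (by linear_combination hl) (by norm_num)
  · exact key 2 (by linear_combination hl - h) (by norm_num)
  · rw [h3] at hl
    norm_num at hl
  · exact key (-1) (by linear_combination ζ * h3 - hl) (by norm_num)
  · exact key 0 (by linear_combination ζ ^ 2 * h3 - hl - h) (by norm_num)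

theorem exists_mem_modularGroup (a b c d : ℤ) (h : a * d - b * c = 1) :
    ∃ γ ∈ modularGroup, γ 0 0 = (a : ℝ) ∧ γ 0 1 = (b : ℝ) ∧ γ 1 0 = (c : ℝ) ∧ γ 1 1 = (d : ℝ) := by
  have hdet : Matrix.det !![a, b; c, d] = 1 := by rw [Matrix.det_fin_two_of, h]
  exact ⟨Matrix.SpecialLinearGroup.map (Int.castRingHom ℝ) ⟨!![a, b; c, d], hdet⟩, ⟨_, rfl⟩,
    rfl, rfl, rfl, rfl⟩

theorem translation_mem_modularGroup : translation ∈ modularGroup := by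
  obtain ⟨γ, hγ, h1, h2, h3, h4⟩ := exists_mem_modularGroup 1 1 0 1 (by norm_num)
  convert hγ
  ext i j
  fin_cases i <;> fin_cases j <;> simp [translation, h1, h2, h3, h4]

/-! ### Generators of the stabilizers and their automorphy factors -/

section

variable {k : ℤ} {f h : ℍ → ℂ}

/-- The matrix (1, -1; 1, 0) fixes ρ with j₀ = ρ, a primitive sixth root of unity, so j₀² has order
3. -/
theorem IsQuasimodular.exponentsCoprime_rho {χ : modularGroup →* ℂ}
    (hq : IsQuasimodular modularGroup χ k f h) (h0 : h ≠ 0) :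
    ExponentsCoprime (potential f h) ((1 + (√(3 : ℝ) : ℂ) * Complex.I) / 2) 3 := by
  obtain ⟨γ, hγ, h1, h2, h3, h4⟩ := exists_mem_modularGroup 1 (-1) 1 0 (by norm_num)
  have hs := ofReal_sqrt_sq (x := 3) (by norm_num)
  push_cast at hs
  have hρ : ((1 + (√(3 : ℝ) : ℂ) * Complex.I) / 2) ^ 2 -
      (1 + (√(3 : ℝ) : ℂ) * Complex.I) / 2 + 1 = 0 := by
    linear_combination (Complex.I ^ 2 / 4) * hs + (3 / 4) * Complex.I_sq
  refine hq.exponentsCoprime h0 translation_mem_modularGroup hγ (by simp [h3]) (by simp)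
    ?_ (by norm_num) ?_
  · rw [h1, h2, h3, h4]
    push_cast
    linear_combination hρ
  · rw [h3, h4]
    generalize (1 + (√(3 : ℝ) : ℂ) * Complex.I) / 2 = ρ at hρ
    refine isPrimitiveRoot_three ?_
    push_cast
    -- This is ρ⁴ + ρ² + 1 = (ρ² + ρ + 1)(ρ² - ρ + 1).
    linear_combination (ρ ^ 2 + ρ + 1) * hρ

theorem IsQuasimodular.exponentsCoprime_I {χ : modularGroup →* ℂ}
    (hq : IsQuasimodular modularGroup χ k f h) (h0 : h ≠ 0) :
    ExponentsCoprime (potential f h) Complex.I 2 := by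
  obtain ⟨γ, hγ, h1, h2, h3, h4⟩ := exists_mem_modularGroup 0 (-1) 1 0 (by norm_num)
  refine hq.exponentsCoprime h0 translation_mem_modularGroup hγ (by simp [h3]) (by simp)
    ?_ (by norm_num) ?_
  · rw [h1, h2, h3, h4]
    push_cast
    linear_combination Complex.I_sq
  · rw [h3, h4]
    convert isPrimitiveRoot_neg_one using 1
    push_cast
    linear_combination Complex.I_sq

variable {N : ℕ} [NeZero N]

theorem sqrt_natCast_pos (N : ℕ) [NeZero N] : 0 < √(N : ℝ) :=
  Real.sqrt_pos.mpr (by exact_mod_cast Nat.pos_of_ne_zero (NeZero.ne N))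

/-- For every N the involution fixes i/√N with j₀ = √N · i/√N = i, so j₀² = -1. -/
theorem IsQuasimodular.exponentsCoprime_fricke {χ : gamma0Plus N →* ℂ}
    (hq : IsQuasimodular (gamma0Plus N) χ k f h) (h0 : h ≠ 0) :
    ExponentsCoprime (potential f h) (Complex.I / (√(N : ℝ) : ℂ)) 2 := by
  have hpos := sqrt_natCast_pos N
  have hne : ((√(N : ℝ) : ℝ) : ℂ) ≠ 0 := by exact_mod_cast hpos.ne'
  refine hq.exponentsCoprime h0 (translation_mem N) (fricke_mem N) ?_ ?_ ?_ (by norm_num) ?_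
  · simpa [fricke] using hpos.ne'
  · rw [Complex.div_ofReal_im, Complex.I_im]
    positivity
  · simp [fricke]
    field_simp
    linear_combination Complex.I_sq
  · convert isPrimitiveRoot_neg_one using 1
    simp [fricke]
    field_simp
    exact Complex.I_sq

theorem translation_mul_fricke_apply (N : ℕ) [NeZero N] :
    (translation * fricke N) 0 0 = √(N : ℝ) ∧ (translation * fricke N) 0 1 = -(1 / √(N : ℝ)) ∧
      (translation * fricke N) 1 0 = √(N : ℝ) ∧ (translation * fricke N) 1 1 = 0 := by
  simp only [Matrix.SpecialLinearGroup.coe_mul, Matrix.mul_apply, Fin.sum_univ_two]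
  simp [translation, fricke]

/-- The matrix (1/√N)(N, -1; N, 0) has j₀ = √N z₀, and its fixed-point equation turns j₀² = N z₀²
into N z₀ - 1. -/
theorem IsQuasimodular.exponentsCoprime_translation_mul_fricke {χ : gamma0Plus N →* ℂ}
    (hq : IsQuasimodular (gamma0Plus N) χ k f h) (h0 : h ≠ 0) {z₀ : ℂ} (hz₀ : 0 < z₀.im)
    (hz : N * z₀ ^ 2 - N * z₀ + 1 = 0) {e : ℕ} (he : 1 < e)
    (hprim : IsPrimitiveRoot (N * z₀ - 1) e) : ExponentsCoprime (potential f h) z₀ e := by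
  have hpos := sqrt_natCast_pos N
  have hne : ((√(N : ℝ) : ℝ) : ℂ) ≠ 0 := by exact_mod_cast hpos.ne'
  have hs := ofReal_sqrt_sq (x := N) (by positivity)
  push_cast at hs
  obtain ⟨h1, h2, h3, h4⟩ := translation_mul_fricke_apply N
  refine hq.exponentsCoprime h0 (translation_mem N)
    (mul_mem (translation_mem N) (fricke_mem N)) ?_ hz₀ ?_ he ?_
  · rw [h3]
    exact hpos.ne'
  · rw [h1, h2, h3, h4]
    push_cast
    field_simp
    linear_combination hz + (z₀ ^ 2 - z₀) * hs
  · convert hprim using 1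
    rw [h3, h4]
    push_cast
    linear_combination hz + z₀ ^ 2 * hs

end

end QuasiMODE

theorem mainTheorem5 :
    -- `SL(2, ℤ)`, with elliptic points `ρ` of order `3` and `i` of order `2`
    (∀ (k : ℤ) (f h : ℍ → ℂ),
      QuasiMODE.IsQuasimodular QuasiMODE.modularGroup 1 k f h → h ≠ 0 →
        QuasiMODE.ExponentsCoprime (QuasiMODE.potential f h)
          ((1 + (√(3 : ℝ) : ℂ) * Complex.I) / 2) 3 ∧
        QuasiMODE.ExponentsCoprime (QuasiMODE.potential f h) Complex.I 2) ∧
    -- `Γ₀⁺(2)` with a character `ε` of `Γ₀⁺(2) / Γ₀(2)`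
    (∀ (ε : QuasiMODE.gamma0Plus 2 →* ℂ),
      (∀ γ : QuasiMODE.gamma0Plus 2, (γ : SL(2, ℝ)) ∈ QuasiMODE.gamma0 2 → ε γ = 1) →
      ∀ (k : ℤ) (f h : ℍ → ℂ),
      QuasiMODE.IsQuasimodular (QuasiMODE.gamma0Plus 2) ε k f h → h ≠ 0 →
        QuasiMODE.ExponentsCoprime (QuasiMODE.potential f h)
          (Complex.I / (√(2 : ℝ) : ℂ)) 2 ∧
        QuasiMODE.ExponentsCoprime (QuasiMODE.potential f h) ((1 + Complex.I) / 2) 4) ∧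
    -- `Γ₀⁺(3)` with the character `χ ^ m`
    (∀ (m : ℕ), m ≤ 3 → ∀ (k : ℤ), k ≡ (m : ℤ) [ZMOD 2] → ∀ (f h : ℍ → ℂ),
      QuasiMODE.IsQuasimodular (QuasiMODE.gamma0Plus 3) (QuasiMODE.chi ^ m) k f h → h ≠ 0 →
        QuasiMODE.ExponentsCoprime (QuasiMODE.potential f h)
          (Complex.I / (√(3 : ℝ) : ℂ)) 2 ∧
        QuasiMODE.ExponentsCoprime (QuasiMODE.potential f h)
          ((3 + (√(3 : ℝ) : ℂ) * Complex.I) / 6) 6) := by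
  have hs := QuasiMODE.ofReal_sqrt_sq (x := 3) (by norm_num)
  push_cast at hs
  refine ⟨fun k f h hq h0 => ⟨hq.exponentsCoprime_rho h0, hq.exponentsCoprime_I h0⟩,
    fun ε _ k f h hq h0 => ⟨by exact_mod_cast hq.exponentsCoprime_fricke h0,
      hq.exponentsCoprime_translation_mul_fricke h0 (by simp) ?_ (by norm_num) ?_⟩,
    fun m _ k _ f h hq h0 => ⟨by exact_mod_cast hq.exponentsCoprime_fricke h0,
      hq.exponentsCoprime_translation_mul_fricke h0 (by simp) ?_ (by norm_num) ?_⟩⟩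
  · push_cast
    linear_combination (1 / 2) * Complex.I_sq
  -- For N = 2 and z₀ = (1 + i)/2, N z₀ - 1 = i.
  · convert QuasiMODE.isPrimitiveRoot_I using 1
    push_cast
    ring
  · push_cast
    linear_combination (Complex.I ^ 2 / 12) * hs + (1 / 4) * Complex.I_sq
  -- For N = 3 and z₀ = (3 + √-3)/6, N z₀ - 1 = (1 + √-3)/2.
  · refine QuasiMODE.isPrimitiveRoot_six ?_
    push_cast
    linear_combination (Complex.I ^ 2 / 4) * hs + (3 / 4) * Complex.I_sq
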